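/- For $d\ge 0$ let $g_d:\{0,1\}^{2^d}\to\{0,1\}$ be the NAND tree function of depth $d$: $g_0(b)=b$, and for $d\ge 1$, $g_d(x)=\mathrm{NAND}(g_{d-1}(x^{(\ell)}),g_{d-1}(x^{(r)}))$, where $x^{(\ell)},x^{(r)}$ are the two halves of $x$ (the complete binary tree of depth $d$ whose leaves are distinct variables and whose internal nodes are binary NAND gates). For $g:\{0,1\}^m\to\{0,1\}$ and a probability distribution $\mu$ on $\{0,1\}^m$, let $\mathsf D^\mu(g)$ be the minimum depth of a deterministic decision tree $T$ with $\Pr_{x\sim\mu}[T(x)\ne g(x)]\le 1/3$, and let $\mathsf D^{\mathsf{prod}}(g)=\max_\mu \mathsf D^\mu(g)$, the maximum being over all product distributions $\mu$ (the bits $x_i$ are independent, $x_i=1$ with probability $p_i\in[0,1]$). A randomized decision tree is a probability distribution over deterministic decision trees, and its query complexity is the maximum depth of a tree in its support. The sabotage complexity $\mathsf{RS}(g)$ is the minimum query complexity of a randomized decision tree $\mathcal R$ such that for all $x\in g^{-1}(0)$, $y\in g^{-1}(1)$, with probability at least $2/3$ a tree $T\sim\mathcal R$ run on $x$ queries an index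 $i$ with $x_i\ne y_i$. Then $\mathsf D^{\mathsf{prod}}(g_d)=O\big(\mathsf{RS}(g_d)^{1-\Omega(1)}\big)$: there are constants $C>0$ and $0<c<1$ such that for all $d\ge 0$, $$\mathsf D^{\mathsf{prod}}(g_d)\le C\cdot \mathsf{RS}(g_d)^{1-c}.$$ Consequently the general bound $\mathsf{RS}(g)=\widetilde\Omega(\mathsf D^{\mathsf{prod}}(g))$ is not tight, even up to polylogarithmic factors: for every integer $k\ge 0$, $\mathsf D^{\mathsf{prod}}(g_d)\cdot(\log \mathsf{RS}(g_d))^k=o(\mathsf{RS}(g_d))$ as $d\to\infty$. -/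

import Mathlib

/-- A deterministic decision tree whose variables are indexed by `ι`. Leaves are labelled by bits;
`query i T₀ T₁` queries the variable `i` and continues with `T₀` if its value is `0` (`false`) and
with `T₁` if its value is `1` (`true`). -/
inductive DecisionTree (ι : Type) : Type
  | leaf (b : Bool) : DecisionTree ι
  | query (i : ι) (T₀ T₁ : DecisionTree ι) : DecisionTree ι

namespace DecisionTree

variable {ι : Type}

/-- The depth of a tree: the largest number of queries on a path from the root to a leaf. -/
def depth : DecisionTree ι → ℕ
  | leaf _ => 0
  | query _ T₀ T₁ => max T₀.depth T₁.depth + 1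

/-- The output of the tree on the input `x`. -/
def eval : DecisionTree ι → (ι → Bool) → Bool
  | leaf b, _ => b
  | query i T₀ T₁, x => if x i then T₁.eval x else T₀.eval x

/-- The indices queried by the tree when it is run on the input `x`, in order. -/
def queried : DecisionTree ι → (ι → Bool) → List ι
  | leaf _, _ => []
  | query i T₀ T₁, x => i :: (if x i then T₁.queried x else T₀.queried x)

/-- When run on `x`, the tree queries an index at which `x` and `y` differ. -/
def Separates (T : DecisionTree ι) (x y : ι → Bool) : Prop :=
  ∃ i ∈ T.queried x, x i ≠ y i

end DecisionTree

noncomputable section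

/-- The probability of the event `S` under the discrete distribution `μ`. -/
def prob {α : Type} (μ : PMF α) (S : Set α) : ℝ :=
  (μ.toOuterMeasure S).toReal

/-- `μ` is a product distribution on `{0,1}^ι`: there are `p i ∈ [0,1]` such that each bit `x i` is
independently `1` with probability `p i`. -/
def IsProductDistribution {ι : Type} [Fintype ι] (μ : PMF (ι → Bool)) : Prop :=
  ∃ p : ι → ℝ, (∀ i, 0 ≤ p i ∧ p i ≤ 1) ∧
    ∀ x : ι → Bool, (μ x).toReal = ∏ i, (if x i then p i else 1 - p i)

/-- The distributional query complexity of `g` with respect to `μ` for error `ε`: the minimum depth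
of a decision tree that errs with probability at most `ε` on an input drawn from `μ`. -/
def distComplexity {ι : Type} (ε : ℝ) (μ : PMF (ι → Bool)) (g : (ι → Bool) → Bool) : ℕ :=
  sInf {k | ∃ T : DecisionTree ι, T.depth = k ∧ prob μ {x | g x ≠ T.eval x} ≤ ε}

/-- The product-distributional query complexity of `g` for error `ε`: the maximum of the
distributional query complexity over all product distributions. -/
def prodComplexityErr {ι : Type} [Fintype ι] (ε : ℝ) (g : (ι → Bool) → Bool) : ℕ :=
  sSup {k | ∃ μ : PMF (ι → Bool), IsProductDistribution μ ∧ distComplexity ε μ g = k}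

/-- The product-distributional query complexity, for error `1/3`. -/
def prodComplexity {ι : Type} [Fintype ι] (g : (ι → Bool) → Bool) : ℕ :=
  prodComplexityErr (1 / 3) g

/-- The randomized decision tree `R` separates, with probability at least `1 - ε`, every pair of
inputs with different values of `g`. -/
def IsSabotageTree {ι : Type} (ε : ℝ) (g : (ι → Bool) → Bool) (R : PMF (DecisionTree ι)) : Prop :=
  ∀ x y : ι → Bool, g x = false → g y = true → 1 - ε ≤ prob R {T | T.Separates x y}

/-- The sabotage complexity of `g` for error `ε`: the least `k` such that some randomized decision
tree, all of whose trees have depth at most `k`, separates every pair of inputs with different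
values of `g` with probability at least `1 - ε`. -/
def sabotageComplexityErr {ι : Type} (ε : ℝ) (g : (ι → Bool) → Bool) : ℕ :=
  sInf {k | ∃ R : PMF (DecisionTree ι), (∀ T ∈ R.support, T.depth ≤ k) ∧ IsSabotageTree ε g R}

/-- The sabotage complexity, for error `1/3`. -/
def sabotageComplexity {ι : Type} (g : (ι → Bool) → Bool) : ℕ :=
  sabotageComplexityErr (1 / 3) g

end

/-- The NAND tree function of depth `d`. Its `2 ^ d` variables are the leaves of the complete binary
tree of depth `d`, a leaf being given by the path of left (`false`) and right (`true`) turns that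
leads to it from the root. -/
def nandTree : (d : ℕ) → ((Fin d → Bool) → Bool) → Bool
  | 0, x => x Fin.elim0
  | d + 1, x =>
    !(nandTree d (fun l => x (Fin.cons false l)) && nandTree d (fun l => x (Fin.cons true l)))

/-! The minima and the maximum in the definitions above exist. -/

namespace DecisionTree

variable {ι : Type}

theorem separates_of_eval_ne (T : DecisionTree ι) (x y : ι → Bool) (h : T.eval x ≠ T.eval y) :
    T.Separates x y := by
  induction T with
  | leaf b => exact absurd rfl h
  | query i T₀ T₁ h₀ h₁ =>
    by_cases hi : x i = y i
    · cases hx : x i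
      · obtain ⟨j, hj, hne⟩ := h₀ (by simpa [eval, ← hi, hx] using h)
        exact ⟨j, by simp [queried, hx, hj], hne⟩
      · obtain ⟨j, hj, hne⟩ := h₁ (by simpa [eval, ← hi, hx] using h)
        exact ⟨j, by simp [queried, hx, hj], hne⟩
    · exact ⟨i, by simp [queried], hi⟩

theorem exists_eval_eq_of_finset [DecidableEq ι] (s : Finset ι) :
    ∀ g : (ι → Bool) → Bool, (∀ x y, (∀ i ∈ s, x i = y i) → g x = g y) →
      ∃ T : DecisionTree ι, T.depth ≤ s.card ∧ ∀ x, T.eval x = g x := by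
  induction s using Finset.induction_on with
  | empty =>
    intro g hg
    exact ⟨leaf (g fun _ => false), by simp [depth], fun x => hg _ _ (by simp)⟩
  | insert i s hi ih =>
    intro g hg
    have key : ∀ b : Bool, ∃ T : DecisionTree ι, T.depth ≤ s.card ∧
        ∀ x, T.eval x = g (Function.update x i b) := by
      intro b
      refine ih _ fun x y h => hg _ _ fun j hj => ?_
      by_cases hji : j = i
      · subst hji; simp
      · simp [hji, h j (Finset.mem_of_mem_insert_of_ne hj hji)]
    obtain ⟨T₀, d₀, e₀⟩ := key false
    obtain ⟨T₁, d₁, e₁⟩ := key true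
    refine ⟨query i T₀ T₁, ?_, fun x => ?_⟩
    · rw [Finset.card_insert_of_notMem hi]
      simp [depth, d₀, d₁]
    · cases hx : x i
      · have hu : Function.update x i false = x := by rw [← hx, Function.update_eq_self]
        simp [eval, hx, e₀, hu]
      · have hu : Function.update x i true = x := by rw [← hx, Function.update_eq_self]
        simp [eval, hx, e₁, hu]

theorem exists_eval_eq [Fintype ι] (g : (ι → Bool) → Bool) :
    ∃ T : DecisionTree ι, T.depth ≤ Fintype.card ι ∧ ∀ x, T.eval x = g x := by
  classical
  exact exists_eval_eq_of_finset Finset.univ g fun x y h =>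
    congrArg g (funext fun i => h i (Finset.mem_univ i))

end DecisionTree

theorem distComplexity_attained {ι : Type} [Fintype ι] {ε : ℝ} (hε : 0 ≤ ε)
    (μ : PMF (ι → Bool)) (g : (ι → Bool) → Bool) :
    ∃ T : DecisionTree ι, T.depth = distComplexity ε μ g ∧ prob μ {x | g x ≠ T.eval x} ≤ ε := by
  obtain ⟨T, -, h⟩ := DecisionTree.exists_eval_eq g
  exact Nat.sInf_mem
    (s := {k | ∃ T : DecisionTree ι, T.depth = k ∧ prob μ {x | g x ≠ T.eval x} ≤ ε})
    ⟨_, T, rfl, by simp [prob, h, hε]⟩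

theorem distComplexity_le_card {ι : Type} [Fintype ι] {ε : ℝ} (hε : 0 ≤ ε)
    (μ : PMF (ι → Bool)) (g : (ι → Bool) → Bool) : distComplexity ε μ g ≤ Fintype.card ι := by
  obtain ⟨T, hd, h⟩ := DecisionTree.exists_eval_eq g
  exact (Nat.sInf_le
    (s := {k | ∃ T : DecisionTree ι, T.depth = k ∧ prob μ {x | g x ≠ T.eval x} ≤ ε})
    ⟨T, rfl, by simp [prob, h, hε]⟩).trans hd

theorem exists_isProductDistribution {ι : Type} [Fintype ι] :
    ∃ μ : PMF (ι → Bool), IsProductDistribution μ := by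
  classical
  refine ⟨PMF.pure fun _ => true, fun _ => 1, fun _ => by norm_num, fun x => ?_⟩
  by_cases hx : x = fun _ => true
  · subst hx; simp
  · obtain ⟨i, hi⟩ : ∃ i, x i ≠ true := by
      by_contra h
      push Not at h
      exact hx (funext h)
    rw [PMF.pure_apply, if_neg hx, Finset.prod_eq_zero (Finset.mem_univ i) (by simp [hi])]
    simp

theorem prodComplexityErr_attained {ι : Type} [Fintype ι] {ε : ℝ} (hε : 0 ≤ ε)
    (g : (ι → Bool) → Bool) :
    IsGreatest {k | ∃ μ : PMF (ι → Bool), IsProductDistribution μ ∧ distComplexity ε μ g = k}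
      (prodComplexityErr ε g) := by
  have hb : BddAbove
      {k | ∃ μ : PMF (ι → Bool), IsProductDistribution μ ∧ distComplexity ε μ g = k} := by
    refine ⟨Fintype.card ι, ?_⟩
    rintro k ⟨μ, -, rfl⟩
    exact distComplexity_le_card hε μ g
  obtain ⟨μ, hμ⟩ := exists_isProductDistribution (ι := ι)
  exact ⟨Nat.sSup_mem ⟨_, μ, hμ, rfl⟩ hb, fun k hk => le_csSup hb hk⟩

theorem sabotageComplexityErr_attained {ι : Type} [Fintype ι] {ε : ℝ} (hε : 0 ≤ ε)
    (g : (ι → Bool) → Bool) :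
    ∃ R : PMF (DecisionTree ι), (∀ T ∈ R.support, T.depth ≤ sabotageComplexityErr ε g) ∧
      IsSabotageTree ε g R := by
  obtain ⟨T, -, h⟩ := DecisionTree.exists_eval_eq g
  refine Nat.sInf_mem (s := {k | ∃ R : PMF (DecisionTree ι), (∀ T ∈ R.support, T.depth ≤ k) ∧
    IsSabotageTree ε g R}) ⟨T.depth, PMF.pure T, by simp, fun x y hx hy => ?_⟩
  have hT : T.Separates x y := T.separates_of_eval_ne x y (by simp [h, hx, hy])
  have : T ∈ {T : DecisionTree ι | T.Separates x y} := hT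
  classical
  rw [prob, PMF.toOuterMeasure_pure_apply, if_pos this]
  simpa using hε

/-! The two measures grow at different exponential rates in the depth: `RS` at least like `(5/3)^d`
(`le_sabotageComplexity_nandTree`), and `D^prod` at most like `(81/50)^d`
(`prodComplexity_nandTree_le`). Since `81/50 < 5/3`, this is a polynomial gap.

Lower bound: a hard distribution on pairs of a 0-input and a 1-input is grown at the leaves. Each
leaf becomes a NAND gate: a 0 turns into two 1s, and a 1 turns into a 0 at a random selected
position and a 1 at the other, with the same selection in both inputs. The two inputs can then
differ only at selected positions. An algorithm on the new inputs is simulated on the old ones by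
drawing the selection and answering 1 at unselected positions for free. With queries weighted by the
pair of values they meet, the simulation saves a factor `5/3` on average (`pairWeight_flip_le`,
`IsHardToSeparate.nand`).

Upper bound: under a product distribution the two halves of the tree are independent. Evaluating
first the half less likely to be 1, and skipping the other when it is 0, has expected cost at most
about `(81/50)^d` (`exists_tree_nandTree_le`). Markov's inequality turns this into a depth bound. -/

/-! ### Lower bound on the sabotage complexity of NAND trees -/

/-- A map sending an input to the set of its queried indices is adaptive if this set does not change
when the input is changed at an index outside of it. -/
def IsAdaptive {ι : Type} [DecidableEq ι] (Q : (ι → Bool) → Finset ι) : Prop :=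
  ∀ x i b, i ∉ Q x → Q (Function.update x i b) = Q x

theorem DecisionTree.queried_update {ι : Type} [DecidableEq ι] (T : DecisionTree ι)
    (x : ι → Bool) (i : ι) (b : Bool) (h : i ∉ T.queried x) :
    T.queried (Function.update x i b) = T.queried x := by
  induction T with
  | leaf _ => rfl
  | query j T₀ T₁ h₀ h₁ =>
    simp only [queried, List.mem_cons, not_or] at h ⊢
    rw [Function.update_of_ne (Ne.symm h.1)]
    cases hx : x j
    · simpa [hx] using h₀ (by simpa [hx] using h.2)
    · simpa [hx] using h₁ (by simpa [hx] using h.2)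

theorem DecisionTree.isAdaptive_queried {ι : Type} [DecidableEq ι] (T : DecisionTree ι) :
    IsAdaptive fun x => (T.queried x).toFinset := fun x i b h => by
  simp only [List.mem_toFinset] at h
  simp only [T.queried_update x i b h]

theorem DecisionTree.length_queried_le_depth {ι : Type} (T : DecisionTree ι) (x : ι → Bool) :
    (T.queried x).length ≤ T.depth := by
  induction T with
  | leaf _ => simp [queried]
  | query i T₀ T₁ h₀ h₁ =>
    cases hx : x i
    · simpa [queried, depth, hx] using Or.inl h₀
    · simpa [queried, depth, hx] using Or.inr h₁

noncomputable section

/-- The cost charged for querying an index at which the two inputs of a pair have the values `b`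
and `b'`. -/
def pairWeight (b b' : Bool) : ℝ :=
  -- The weights are chosen for the factor `5/3`. A query into two shared 1s is simulated for half
  -- of the selections, which matches `5/3 * 6/5 = 2`. For values 1 and 0, finding the selected bit
  -- under both selections is tight: `5/3 * (2 * 3/4) = 2 * 3/4 + 1`. For a shared 1 the same case
  -- leaves slack: `5/3 * 2 ≤ 2 * 6/5 + 1`.
  if b = b' then (if b then 1 else 6 / 5) else 3 / 4

theorem pairWeight_le (b b' : Bool) : pairWeight b b' ≤ 6 / 5 := by
  cases b <;> cases b' <;> norm_num [pairWeight]

/-- There is a distribution on pairs of a `0`-input and a `1`-input of `g` for which every adaptive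
query algorithm has an expected cost of at least `V` times its probability to separate the pair. The
distribution is uniform over a finite family. -/
def IsHardToSeparate {ι : Type} [DecidableEq ι] (g : (ι → Bool) → Bool) (V : ℝ) : Prop :=
  ∃ (Ω : Type) (_ : Fintype Ω) (_ : Nonempty Ω) (X Y : Ω → ι → Bool),
    (∀ ω, g (X ω) = false ∧ g (Y ω) = true) ∧
    ∀ Q : (ι → Bool) → Finset ι, IsAdaptive Q →
      V * ∑ ω, (if ∃ i ∈ Q (X ω), X ω i ≠ Y ω i then 1 else 0) ≤
        ∑ ω, ∑ i ∈ Q (X ω), pairWeight (X ω i) (Y ω i)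

/-! ### Replacing every leaf by a NAND gate -/

/-- The input of pairs of bits whose NANDs form the input `x`, in which the bit that is not selected
by `s` is `1`. -/
def nandLift {ι : Type} (s x : ι → Bool) : ι × Bool → Bool :=
  fun j => if j.2 = s j.1 then !x j.1 else true

/-- The queries to `x` needed to simulate `Q` on `nandLift s x`. -/
def simulateQueries {ι : Type} [Fintype ι] [DecidableEq ι]
    (Q : (ι × Bool → Bool) → Finset (ι × Bool)) (s x : ι → Bool) : Finset ι :=
  {u | (u, s u) ∈ Q (nandLift s x)}

theorem nand_nandLift {ι : Type} (s x : ι → Bool) (u : ι) :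
    (!(nandLift s x (u, false) && nandLift s x (u, true))) = x u := by
  cases h : s u <;> simp [nandLift, h]

theorem nandLift_update {ι : Type} [DecidableEq ι] (s x : ι → Bool) (u : ι) (b : Bool) :
    nandLift s (Function.update x u b) = Function.update (nandLift s x) (u, s u) (!b) := by
  funext ⟨v, c⟩
  by_cases hv : v = u
  · subst hv
    by_cases hc : c = s v <;> simp [nandLift, hc]
  · simp [nandLift, hv]

theorem IsAdaptive.simulateQueries {ι : Type} [Fintype ι] [DecidableEq ι]
    {Q : (ι × Bool → Bool) → Finset (ι × Bool)} (hQ : IsAdaptive Q) (s : ι → Bool) :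
    IsAdaptive (simulateQueries Q s) := by
  intro x u b h
  have h' : (u, s u) ∉ Q (nandLift s x) := by simpa [_root_.simulateQueries] using h
  simp only [_root_.simulateQueries, nandLift_update, hQ _ _ _ h']

/-- Unselected bits are 1 in both lifts and selected bits are negated, so the simulation preserves
separation exactly, for each fixed selection. -/
theorem exists_separating_simulateQueries {ι : Type} [Fintype ι] [DecidableEq ι]
    (Q : (ι × Bool → Bool) → Finset (ι × Bool)) (s x y : ι → Bool) :
    (∃ j ∈ Q (nandLift s x), nandLift s x j ≠ nandLift s y j) ↔
      ∃ u ∈ simulateQueries Q s x, x u ≠ y u := by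
  constructor
  · rintro ⟨⟨u, b⟩, hj, hne⟩
    by_cases hb : b = s u
    · subst hb
      exact ⟨u, by simpa [simulateQueries] using hj, by simpa [nandLift] using hne⟩
    · simp [nandLift, hb] at hne
  · rintro ⟨u, hu, hne⟩
    exact ⟨(u, s u), by simpa [simulateQueries] using hu, by simpa [nandLift] using hne⟩

/-- Both sides put `!x u` at both positions of `u`. This links the runs on the two lifts that differ
in the selection at `u`. -/
theorem nandLift_flip_update {ι : Type} [DecidableEq ι] (s x : ι → Bool) (u : ι) :
    Function.update (nandLift s x) (u, !s u) (!x u) =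
      Function.update (nandLift (Function.update s u (!s u)) x) (u, s u) (!x u) := by
  funext ⟨v, c⟩
  by_cases hv : v = u
  · subst hv
    by_cases hc : c = s v
    · subst hc; simp [nandLift]
    · have : c = !s v := by cases c <;> cases h : s v <;> simp_all
      subst this; simp [nandLift]
  · simp [nandLift, hv]

theorem nandLift_flip_of_eq_false {ι : Type} [DecidableEq ι] (s x : ι → Bool) (u : ι)
    (hx : x u = false) : nandLift (Function.update s u (!s u)) x = nandLift s x := by
  funext ⟨v, c⟩
  by_cases hv : v = u
  · subst hv; simp [nandLift, hx]
  · simp [nandLift, hv]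

/-- The queries made to one pair of bits, averaged over the choice of the selected bit. -/
theorem pairWeight_flip_le {ι : Type} [Fintype ι] [DecidableEq ι]
    {Q : (ι × Bool → Bool) → Finset (ι × Bool)} (hQ : IsAdaptive Q) (s x y : ι → Bool) (u : ι) :
    let s' := Function.update s u (!s u)
    5 / 3 * ((if (u, s u) ∈ Q (nandLift s x) then pairWeight (x u) (y u) else 0) +
        (if (u, !s u) ∈ Q (nandLift s' x) then pairWeight (x u) (y u) else 0)) ≤
      ((if (u, s u) ∈ Q (nandLift s x) then pairWeight (!x u) (!y u) else 0) +
        (if (u, !s u) ∈ Q (nandLift s x) then pairWeight true true else 0)) +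
      ((if (u, !s u) ∈ Q (nandLift s' x) then pairWeight (!x u) (!y u) else 0) +
        (if (u, s u) ∈ Q (nandLift s' x) then pairWeight true true else 0)) := by
  intro s'
  -- If neither run queries its unselected bit at `u`, adaptivity identifies both query sets with
  -- that of the common updated input. Then neither run queries `u` at all: a hidden 0 cannot always
  -- be found at the first attempt.
  have key : (u, !s u) ∉ Q (nandLift s x) → (u, s u) ∉ Q (nandLift s' x) →
      Q (nandLift s x) = Q (nandLift s' x) := fun h₁ h₂ => by
    rw [← hQ _ _ (!x u) h₁, ← hQ _ _ (!x u) h₂, nandLift_flip_update]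
  have hsame : x u = false → Q (nandLift s' x) = Q (nandLift s x) := fun h => by
    rw [nandLift_flip_of_eq_false s x u h]
  generalize Q (nandLift s x) = A at *
  generalize Q (nandLift s' x) = B at *
  cases hx : x u
  · rw [hsame hx]
    cases y u <;> by_cases h₁ : (u, s u) ∈ A <;> by_cases h₂ : (u, !s u) ∈ A <;>
      norm_num [h₁, h₂, pairWeight]
  · by_cases h₁ : (u, !s u) ∈ A
    · cases y u <;> by_cases h₂ : (u, s u) ∈ A <;> by_cases h₃ : (u, s u) ∈ B <;>
        by_cases h₄ : (u, !s u) ∈ B <;> norm_num [h₁, h₂, h₃, h₄, pairWeight]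
    · by_cases h₃ : (u, s u) ∈ B
      · cases y u <;> by_cases h₂ : (u, s u) ∈ A <;>
          by_cases h₄ : (u, !s u) ∈ B <;> norm_num [h₁, h₂, h₃, h₄, pairWeight]
      · have := key h₁ h₃
        subst this
        simp [h₁, h₃]

/-- Selections are paired by flipping them at `u`, separately for each `u`, which reduces the
average to the local inequality `pairWeight_flip_le`. -/
theorem sum_simulateQueries_le {ι : Type} [Fintype ι] [DecidableEq ι]
    {Q : (ι × Bool → Bool) → Finset (ι × Bool)} (hQ : IsAdaptive Q) (x y : ι → Bool) :
    5 / 3 * ∑ s, ∑ u ∈ simulateQueries Q s x, pairWeight (x u) (y u) ≤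
      ∑ s, ∑ j ∈ Q (nandLift s x), pairWeight (nandLift s x j) (nandLift s y j) := by
  let F : ι → (ι → Bool) → ℝ := fun u s =>
    if (u, s u) ∈ Q (nandLift s x) then pairWeight (x u) (y u) else 0
  let G : ι → (ι → Bool) → ℝ := fun u s =>
    (if (u, s u) ∈ Q (nandLift s x) then pairWeight (!x u) (!y u) else 0) +
      (if (u, !s u) ∈ Q (nandLift s x) then pairWeight true true else 0)
  have hF : ∀ s, ∑ u ∈ simulateQueries Q s x, pairWeight (x u) (y u) = ∑ u, F u s := fun s => by
    simp only [simulateQueries, Finset.sum_filter, F]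
  have hG : ∀ s, ∑ j ∈ Q (nandLift s x), pairWeight (nandLift s x j) (nandLift s y j) =
      ∑ u, G u s := fun s => by
    rw [← Finset.sum_ite_mem_eq, Fintype.sum_prod_type]
    refine Finset.sum_congr rfl fun u _ => ?_
    cases hs : s u <;> simp [G, nandLift, hs, add_comm]
  simp only [hF, hG]
  rw [Finset.sum_comm, Finset.sum_comm (s := Finset.univ) (f := fun s u => G u s), Finset.mul_sum]
  refine Finset.sum_le_sum fun u _ => ?_
  have hinv : Function.Involutive fun s : ι → Bool => Function.update s u (!s u) := fun s => by
    simp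
  have hsum : ∀ H : (ι → Bool) → ℝ,
      ∑ s, H (Function.update s u (!s u)) = ∑ s, H s := fun H =>
    Equiv.sum_comp hinv.toPerm H
  have h2 : 5 / 3 * ∑ s, (F u s + F u (Function.update s u (!s u))) ≤
      ∑ s, (G u s + G u (Function.update s u (!s u))) := by
    rw [Finset.mul_sum]
    refine Finset.sum_le_sum fun s _ => ?_
    simpa [F, G] using pairWeight_flip_le hQ s x y u
  rw [Finset.sum_add_distrib, Finset.sum_add_distrib, hsum (F u), hsum (G u)] at h2
  linarith

theorem IsHardToSeparate.nand {ι : Type} [Fintype ι] [DecidableEq ι] {g : (ι → Bool) → Bool}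
    {V : ℝ} (h : IsHardToSeparate g V) :
    IsHardToSeparate (fun z : ι × Bool → Bool => g fun u => !(z (u, false) && z (u, true)))
      (5 / 3 * V) := by
  obtain ⟨Ω, _, _, X, Y, hg, hV⟩ := h
  refine ⟨(ι → Bool) × Ω, inferInstance, inferInstance, fun ω => nandLift ω.1 (X ω.2),
    fun ω => nandLift ω.1 (Y ω.2), fun ω => ?_, fun Q hQ => ?_⟩
  · simpa only [nand_nandLift] using hg ω.2
  · simp only [exists_separating_simulateQueries, Fintype.sum_prod_type]
    calc _ = 5 / 3 * ∑ s, V * ∑ ω,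
            (if ∃ u ∈ simulateQueries Q s (X ω), X ω u ≠ Y ω u then (1 : ℝ) else 0) := by
          rw [mul_assoc, Finset.mul_sum]
      _ ≤ 5 / 3 * ∑ s, ∑ ω, ∑ u ∈ simulateQueries Q s (X ω), pairWeight (X ω u) (Y ω u) := by
          gcongr with s
          exact hV _ (hQ.simulateQueries s)
      _ = ∑ ω, 5 / 3 * ∑ s, ∑ u ∈ simulateQueries Q s (X ω), pairWeight (X ω u) (Y ω u) := by
          rw [Finset.sum_comm, Finset.mul_sum]
      _ ≤ _ := by
          rw [Finset.sum_comm (s := Finset.univ (α := ι → Bool))]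
          exact Finset.sum_le_sum fun ω _ => sum_simulateQueries_le hQ _ _

theorem IsHardToSeparate.reindex {ι κ : Type} [DecidableEq ι] [DecidableEq κ]
    {g : (ι → Bool) → Bool} {V : ℝ} (h : IsHardToSeparate g V) (e : ι ≃ κ) :
    IsHardToSeparate (fun z : κ → Bool => g fun i => z (e i)) V := by
  obtain ⟨Ω, _, _, X, Y, hg, hV⟩ := h
  refine ⟨Ω, inferInstance, inferInstance, fun ω k => X ω (e.symm k), fun ω k => Y ω (e.symm k),
    by simpa using hg, fun Q hQ => ?_⟩
  have hQ' : IsAdaptive fun x : ι → Bool =>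
      (Q fun k => x (e.symm k)).map e.symm.toEmbedding := by
    intro x i b hi
    have hu : (fun k => Function.update x i b (e.symm k)) =
        Function.update (fun k => x (e.symm k)) (e i) b := by
      funext k
      simp [Function.update_apply, Equiv.symm_apply_eq]
    simp only [hu]
    rw [hQ]
    simpa using hi
  refine le_of_eq_of_le ?_ ((hV _ hQ').trans_eq (by simp))
  refine congrArg _ (Finset.sum_congr rfl fun ω _ => if_congr ⟨?_, ?_⟩ rfl rfl)
  · rintro ⟨k, hk, hne⟩
    exact ⟨e.symm k, Finset.mem_map_of_mem _ hk, hne⟩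
  · rintro ⟨i, hi, hne⟩
    obtain ⟨k, hk, rfl⟩ := Finset.mem_map.1 hi
    exact ⟨k, hk, hne⟩

/-- The definition unfolds at the root, while the hard pairs grow at the leaves. -/
theorem nandTree_succ_eq_snoc (d : ℕ) (x : (Fin (d + 1) → Bool) → Bool) :
    nandTree (d + 1) x = nandTree d fun u =>
      !(x (Fin.snoc (α := fun _ => Bool) u false) && x (Fin.snoc (α := fun _ => Bool) u true)) := by
  induction d with
  | zero =>
    have h : ∀ b : Bool, ∀ u : Fin 0 → Bool,
        (Fin.cons b u : Fin 1 → Bool) = Fin.snoc (α := fun _ => Bool) Fin.elim0 b := by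
      intro b u; funext i; fin_cases i; rfl
    simp only [nandTree, h]
  | succ d ih =>
    rw [nandTree, ih, ih]
    conv_rhs => rw [nandTree]
    simp only [Fin.cons_snoc_eq_snoc_cons]

theorem isHardToSeparate_nandTree (d : ℕ) :
    IsHardToSeparate (nandTree d) (3 / 4 * (5 / 3) ^ d) := by
  induction d with
  | zero =>
    refine ⟨Unit, inferInstance, inferInstance, fun _ _ => false, fun _ _ => true,
      by simp [nandTree], fun Q _ => ?_⟩
    -- There is a single variable, so a query set either is empty or separates the pair at cost
    -- `3/4`.
    by_cases h : (Q fun _ => false) = ∅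
    · simp [h]
    · obtain ⟨i, hi⟩ := Finset.nonempty_iff_ne_empty.2 h
      have hc : (1 : ℝ) ≤ ((Q fun _ => false).card : ℝ) := by
        exact_mod_cast Finset.card_pos.2 ⟨i, hi⟩
      have hs : ∃ i ∈ Q fun _ => false, false ≠ true := ⟨i, hi, Bool.false_ne_true⟩
      simp only [if_pos hs, pairWeight, Finset.univ_unique, Finset.sum_const,
        Finset.card_singleton, nsmul_eq_mul, Bool.false_eq_true, if_false,
        pow_zero, Nat.cast_one]
      linarith
  | succ d ih =>
    have := ih.nand.reindex
      ((Equiv.prodComm _ _).trans (Fin.snocEquiv fun _ : Fin (d + 1) => Bool))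
    convert this using 1
    · funext x
      rw [nandTree_succ_eq_snoc]
      rfl
    · ring

/-! ### From hard pairs to sabotage complexity -/

theorem sum_prob_le {α Ω : Type} [Fintype Ω] (R : PMF α) (P : α → Ω → Prop) (M : ℝ)
    [∀ a ω, Decidable (P a ω)]
    (h : ∀ a ∈ R.support, ∑ ω, (if P a ω then 1 else 0) ≤ M) :
    ∑ ω, prob R {a | P a ω} ≤ M := by
  obtain ⟨a, ha⟩ := R.support_nonempty
  have hM : 0 ≤ M := le_trans (Finset.sum_nonneg fun _ _ => by split_ifs <;> norm_num) (h a ha)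
  have hfin : ∀ ω, R.toOuterMeasure {a | P a ω} ≠ ⊤ := fun ω =>
    ne_top_of_le_ne_top ENNReal.one_ne_top (by
      rw [PMF.toOuterMeasure_apply, ← R.tsum_coe]
      exact ENNReal.tsum_le_tsum fun a => Set.indicator_le_self _ _ a)
  simp only [prob]
  rw [← ENNReal.toReal_sum fun ω _ => hfin ω]
  refine ENNReal.toReal_le_of_le_ofReal hM ?_
  simp only [PMF.toOuterMeasure_apply]
  rw [← Summable.tsum_finsetSum fun _ _ => ENNReal.summable]
  calc _ ≤ ∑' a, R a * ENNReal.ofReal M := ENNReal.tsum_le_tsum fun a => ?_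
    _ = ENNReal.ofReal M := by rw [ENNReal.tsum_mul_right, R.tsum_coe, one_mul]
  by_cases ha : a ∈ R.support
  · calc _ = R a * ∑ ω, (if P a ω then 1 else 0) := by
          rw [Finset.mul_sum]
          refine Finset.sum_congr rfl fun ω _ => ?_
          by_cases hP : P a ω <;> simp [hP]
      _ = R a * ENNReal.ofReal (∑ ω, (if P a ω then 1 else 0)) := by
          rw [ENNReal.ofReal_sum_of_nonneg fun _ _ => by split_ifs <;> norm_num]
          congr 1
          refine Finset.sum_congr rfl fun ω _ => ?_
          split_ifs <;> simp
      _ ≤ _ := by gcongr; exact h a ha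
  · have : R a = 0 := by simpa [PMF.mem_support_iff] using ha
    simp [Set.indicator_apply, this]

/-- This is the easy direction of Yao's principle: a tree of depth `k` has cost at most `6/5 * k` on
every pair, while the separation probability averages to at least `2/3`. Hence `2/3 * V ≤ 6/5 * k`.
-/
theorem IsHardToSeparate.le_sabotageComplexity {ι : Type} [Fintype ι] [DecidableEq ι]
    {g : (ι → Bool) → Bool} {V : ℝ} (hV : 0 < V) (h : IsHardToSeparate g V) :
    5 / 9 * V ≤ sabotageComplexity g := by
  classical
  obtain ⟨Ω, _, _, X, Y, hg, hQ⟩ := h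
  obtain ⟨R, hdepth, hR⟩ := sabotageComplexityErr_attained (ε := 1 / 3) (by norm_num) g
  change ∀ T ∈ R.support, T.depth ≤ sabotageComplexity g at hdepth
  set k := sabotageComplexity g
  have hN : (0 : ℝ) < Fintype.card Ω := by exact_mod_cast Fintype.card_pos
  have hupper : ∑ ω, prob R {T | T.Separates (X ω) (Y ω)} ≤
      6 / 5 * k * Fintype.card Ω / V := by
    refine sum_prob_le R (fun T ω => T.Separates (X ω) (Y ω)) _ fun T hT => ?_
    rw [le_div_iff₀ hV, mul_comm]
    calc _ ≤ ∑ ω, ∑ i ∈ (T.queried (X ω)).toFinset, pairWeight (X ω i) (Y ω i) := by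
          refine le_of_eq_of_le ?_ (hQ _ T.isAdaptive_queried)
          exact congrArg _ (Finset.sum_congr rfl fun ω _ =>
            if_congr (by simp [DecisionTree.Separates]) rfl rfl)
      _ ≤ ∑ _ω : Ω, 6 / 5 * (k : ℝ) := Finset.sum_le_sum fun ω _ => by
          calc _ ≤ ∑ i ∈ (T.queried (X ω)).toFinset, (6 / 5 : ℝ) :=
                Finset.sum_le_sum fun _ _ => pairWeight_le _ _
            _ = 6 / 5 * ((T.queried (X ω)).toFinset.card : ℝ) := by
                rw [Finset.sum_const, nsmul_eq_mul, mul_comm]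
            _ ≤ _ := by
                gcongr
                exact (List.toFinset_card_le _).trans
                  ((T.length_queried_le_depth _).trans (hdepth T hT))
      _ = _ := by rw [Finset.sum_const, Finset.card_univ, nsmul_eq_mul, mul_comm]
  have hlower : 2 / 3 * (Fintype.card Ω : ℝ) ≤
      ∑ ω, prob R {T | T.Separates (X ω) (Y ω)} := by
    calc _ = ∑ _ω : Ω, (2 / 3 : ℝ) := by
          rw [Finset.sum_const, Finset.card_univ, nsmul_eq_mul, mul_comm]
      _ ≤ _ := Finset.sum_le_sum fun ω _ => by
          have := hR (X ω) (Y ω) (hg ω).1 (hg ω).2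
          linarith
  have := hlower.trans hupper
  rw [le_div_iff₀ hV] at this
  have h3 : 2 / 3 * V ≤ 6 / 5 * k := le_of_mul_le_mul_right (by linarith) hN
  linarith

theorem le_sabotageComplexity_nandTree (d : ℕ) :
    5 / 12 * (5 / 3 : ℝ) ^ d ≤ sabotageComplexity (nandTree d) := by
  have := (isHardToSeparate_nandTree d).le_sabotageComplexity (by positivity)
  linarith

end

/-! ### Upper bound on the product-distributional complexity of NAND trees -/

namespace DecisionTree

variable {ι κ : Type}

/-- The tree over the variables `f i` that queries as `T` does and continues with `F b` where `T`
outputs `b`. -/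
def mapBind (f : ι → κ) (F : Bool → DecisionTree κ) : DecisionTree ι → DecisionTree κ
  | leaf b => F b
  | query i T₀ T₁ => query (f i) (mapBind f F T₀) (mapBind f F T₁)

theorem eval_mapBind (f : ι → κ) (F : Bool → DecisionTree κ) (T : DecisionTree ι) (x : κ → Bool) :
    (T.mapBind f F).eval x = (F (T.eval fun i => x (f i))).eval x := by
  induction T with
  | leaf b => rfl
  | query i T₀ T₁ h₀ h₁ => cases hx : x (f i) <;> simp [mapBind, eval, hx, h₀, h₁]

theorem length_queried_mapBind (f : ι → κ) (F : Bool → DecisionTree κ) (T : DecisionTree ι)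
    (x : κ → Bool) :
    ((T.mapBind f F).queried x).length =
      (T.queried fun i => x (f i)).length + ((F (T.eval fun i => x (f i))).queried x).length := by
  induction T with
  | leaf b => simp [mapBind, queried, eval]
  | query i T₀ T₁ h₀ h₁ =>
    cases hx : x (f i) <;> simp [mapBind, queried, eval, hx, h₀, h₁] <;> omega

/-- The tree that stops after `n` queries. -/
def truncate : ℕ → DecisionTree ι → DecisionTree ι
  | _, leaf b => leaf b
  -- The output of an interrupted run is irrelevant, since such runs are all counted as errors.
  | 0, query _ _ _ => leaf false
  | n + 1, query i T₀ T₁ => query i (truncate n T₀) (truncate n T₁)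

theorem depth_truncate_le (n : ℕ) (T : DecisionTree ι) : (T.truncate n).depth ≤ n := by
  induction T generalizing n with
  | leaf b => cases n <;> simp [truncate, depth]
  | query i T₀ T₁ h₀ h₁ => cases n <;> simp [truncate, depth, h₀, h₁]

theorem eval_truncate (n : ℕ) (T : DecisionTree ι) (x : ι → Bool)
    (h : (T.queried x).length ≤ n) : (T.truncate n).eval x = T.eval x := by
  induction T generalizing n with
  | leaf b => cases n <;> rfl
  | query i T₀ T₁ h₀ h₁ =>
    cases n with
    | zero => simp [queried] at h
    | succ n =>
      cases hx : x i
      · simpa [truncate, eval, hx] using h₀ n (by simpa [queried, hx] using h)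
      · simpa [truncate, eval, hx] using h₁ n (by simpa [queried, hx] using h)

end DecisionTree

noncomputable section

/-! ### Independent bits and the two halves of the tree -/

/-- The expectation of `f` when the bits of the input are independent, the bit `i` being `1` with
probability `p i`. -/
def prodExpect {ι : Type} [Fintype ι] [DecidableEq ι] (p : ι → ℝ) (f : (ι → Bool) → ℝ) : ℝ :=
  ∑ x : ι → Bool, (∏ i, if x i then p i else 1 - p i) * f x

section prodExpect

variable {ι : Type} [Fintype ι] [DecidableEq ι] {p : ι → ℝ}

theorem prodExpect_add (f g : (ι → Bool) → ℝ) :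
    prodExpect p (fun x => f x + g x) = prodExpect p f + prodExpect p g := by
  simp [prodExpect, mul_add, Finset.sum_add_distrib]

theorem prodExpect_sub (f g : (ι → Bool) → ℝ) :
    prodExpect p (fun x => f x - g x) = prodExpect p f - prodExpect p g := by
  simp [prodExpect, mul_sub, Finset.sum_sub_distrib]

theorem prodExpect_one : prodExpect p (fun _ => 1) = 1 := by
  simp only [prodExpect, mul_one]
  rw [← Fintype.piFinset_univ,
    Finset.sum_prod_piFinset Finset.univ fun i (b : Bool) => if b then p i else 1 - p i]
  simp

theorem prodExpect_mono (hp : ∀ i, 0 ≤ p i ∧ p i ≤ 1) {f g : (ι → Bool) → ℝ}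
    (h : ∀ x, f x ≤ g x) : prodExpect p f ≤ prodExpect p g := by
  refine Finset.sum_le_sum fun x _ => mul_le_mul_of_nonneg_left (h x) ?_
  refine Finset.prod_nonneg fun i _ => ?_
  have := hp i
  split_ifs <;> linarith

theorem prodExpect_nonneg (hp : ∀ i, 0 ≤ p i ∧ p i ≤ 1) {f : (ι → Bool) → ℝ}
    (h : ∀ x, 0 ≤ f x) : 0 ≤ prodExpect p f := by
  simpa [prodExpect] using prodExpect_mono hp h

end prodExpect

/-- The restriction of a labelling of the leaves of the tree of depth `d + 1` to one half. -/
def half {d : ℕ} {α : Type} (b : Bool) (x : (Fin (d + 1) → Bool) → α) : (Fin d → Bool) → α :=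
  fun l => x (Fin.cons b l)

theorem prodExpect_half_mul_half {d : ℕ} (p : (Fin (d + 1) → Bool) → ℝ)
    (f g : ((Fin d → Bool) → Bool) → ℝ) (b : Bool) :
    prodExpect p (fun x => f (half b x) * g (half (!b) x)) =
      prodExpect (half b p) f * prodExpect (half (!b) p) g := by
  have main : ∀ f g : ((Fin d → Bool) → Bool) → ℝ,
      prodExpect p (fun x => f (half false x) * g (half true x)) =
        prodExpect (half false p) f * prodExpect (half true p) g := by
    intro f g
    let e : ((Fin (d + 1) → Bool) → Bool) ≃ ((Fin d → Bool) → Bool) × ((Fin d → Bool) → Bool) :=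
      { toFun := fun x => (half false x, half true x)
        invFun := fun y l => if l 0 then y.2 (Fin.tail l) else y.1 (Fin.tail l)
        left_inv := fun x => by
          funext l
          have hl := Fin.cons_self_tail l
          cases h : l 0 <;> rw [h] at hl <;> simp [half, h, hl]
        right_inv := fun y => by
          refine Prod.ext ?_ ?_ <;> funext l <;> simp [half, Fin.tail_cons] }
    simp only [prodExpect]
    rw [Finset.sum_mul_sum, ← Finset.sum_product', Finset.univ_product_univ]
    refine Fintype.sum_equiv e _ _ fun x => ?_
    have hprod : (∏ l, if x l then p l else 1 - p l) =
        (∏ l, if half false x l then half false p l else 1 - half false p l) *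
          ∏ l, if half true x l then half true p l else 1 - half true p l := by
      rw [← (Fin.consEquiv fun _ : Fin (d + 1) => Bool).prod_comp, Fintype.prod_prod_type,
        Fintype.prod_bool, mul_comm]
      rfl
    rw [hprod]
    simp only [e, Equiv.coe_fn_mk]
    ring
  cases b
  · exact main f g
  · have := main g f
    rw [mul_comm (prodExpect (half true p) f)]
    simpa [mul_comm] using this

theorem prodExpect_half {d : ℕ} (p : (Fin (d + 1) → Bool) → ℝ)
    (f : ((Fin d → Bool) → Bool) → ℝ) (b : Bool) :
    prodExpect p (fun x => f (half b x)) = prodExpect (half b p) f := by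
  have := prodExpect_half_mul_half p f (fun _ => 1) b
  simpa [prodExpect_one] using this

theorem nandTree_succ_eq_half {d : ℕ} (b : Bool) (x : (Fin (d + 1) → Bool) → Bool) :
    nandTree (d + 1) x = !(nandTree d (half b x) && nandTree d (half (!b) x)) := by
  cases b
  · rfl
  · rw [Bool.and_comm]; rfl

/-! ### Expected cost of evaluating a NAND tree -/

/-- The probability that the NAND tree evaluates to `1`. -/
def nandProb (d : ℕ) (p : (Fin d → Bool) → ℝ) : ℝ :=
  prodExpect p fun x => if nandTree d x then 1 else 0

theorem nandProb_nonneg {d : ℕ} {p : (Fin d → Bool) → ℝ} (hp : ∀ i, 0 ≤ p i ∧ p i ≤ 1) :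
    0 ≤ nandProb d p :=
  prodExpect_nonneg hp fun x => by split_ifs <;> norm_num

theorem nandProb_le_one {d : ℕ} {p : (Fin d → Bool) → ℝ} (hp : ∀ i, 0 ≤ p i ∧ p i ≤ 1) :
    nandProb d p ≤ 1 := by
  rw [← prodExpect_one (p := p)]
  exact prodExpect_mono hp fun x => by split_ifs <;> norm_num

theorem nandProb_succ {d : ℕ} (p : (Fin (d + 1) → Bool) → ℝ) (b : Bool) :
    nandProb (d + 1) p = 1 - nandProb d (half b p) * nandProb d (half (!b) p) := by
  rw [nandProb, nandProb, nandProb, ← prodExpect_half_mul_half]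
  conv_rhs => enter [1]; rw [← prodExpect_one (p := p)]
  rw [← prodExpect_sub]
  congr 1
  funext x
  rw [nandTree_succ_eq_half b]
  cases nandTree d (half b x) <;> cases nandTree d (half (!b) x) <;> simp

/-- Evaluating the half `b` first, and the other one only if necessary. -/
theorem exists_tree_nandTree_succ {d : ℕ} (p : (Fin (d + 1) → Bool) → ℝ) (b : Bool)
    {T T' : DecisionTree (Fin d → Bool)} (hT : ∀ x, T.eval x = nandTree d x)
    (hT' : ∀ x, T'.eval x = nandTree d x) :
    ∃ S : DecisionTree (Fin (d + 1) → Bool), (∀ x, S.eval x = nandTree (d + 1) x) ∧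
      prodExpect p (fun x => ((S.queried x).length : ℝ)) =
        prodExpect (half b p) (fun x => ((T.queried x).length : ℝ)) +
          nandProb d (half b p) *
            prodExpect (half (!b) p) (fun x => ((T'.queried x).length : ℝ)) := by
  let F : Bool → DecisionTree (Fin (d + 1) → Bool) := fun c =>
    if c then T'.mapBind (fun l => Fin.cons (!b) l) fun c' => .leaf (!c') else .leaf true
  refine ⟨T.mapBind (fun l => Fin.cons b l) F, fun x => ?_, ?_⟩
  · rw [DecisionTree.eval_mapBind, hT, nandTree_succ_eq_half b]
    change (F (nandTree d (half b x))).eval x = _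
    cases nandTree d (half b x)
    · simp [F, DecisionTree.eval]
    · simp only [F, if_true, DecisionTree.eval_mapBind, DecisionTree.eval, hT', Bool.true_and]
      rfl
  · rw [nandProb, ← prodExpect_half_mul_half, ← prodExpect_half, ← prodExpect_add]
    congr 1
    funext x
    rw [DecisionTree.length_queried_mapBind, hT]
    change (((T.queried (half b x)).length +
      ((F (nandTree d (half b x))).queried x).length : ℕ) : ℝ) = _
    cases nandTree d (half b x)
    · simp [F, DecisionTree.queried]
    · simp only [F, if_true, DecisionTree.length_queried_mapBind, DecisionTree.queried]
      simp only [List.length_nil, add_zero, Nat.cast_add, one_mul]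
      rfl

/-- The factor `1 + 31/100 * (1 - nandProb d p)` strengthens the induction: trees likely to be 0 are
allowed a higher cost, as they make skipping their sibling likely. The rate `81/50` lies just above
the golden ratio, the growth factor `1 + u` at the fixed point `u = 1 - u ^ 2`. -/
theorem exists_tree_nandTree_le (d : ℕ) (p : (Fin d → Bool) → ℝ)
    (hp : ∀ i, 0 ≤ p i ∧ p i ≤ 1) :
    ∃ T : DecisionTree (Fin d → Bool), (∀ x, T.eval x = nandTree d x) ∧
      prodExpect p (fun x => ((T.queried x).length : ℝ)) ≤
        (81 / 50) ^ d * (1 + 31 / 100 * (1 - nandProb d p)) := by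
  induction d with
  | zero =>
    refine ⟨.query Fin.elim0 (.leaf false) (.leaf true), fun x => ?_, ?_⟩
    · cases h : x Fin.elim0 <;> simp [DecisionTree.eval, nandTree, h]
    · have : ∀ x : (Fin 0 → Bool) → Bool,
          ((DecisionTree.query Fin.elim0 (.leaf false) (.leaf true)).queried x).length = 1 := by
        intro x
        cases h : x Fin.elim0 <;> simp [DecisionTree.queried, h]
      simp only [this, Nat.cast_one, prodExpect_one]
      linarith [nandProb_le_one hp]
  | succ d ih =>
    have hph : ∀ b i, 0 ≤ half b p i ∧ half b p i ≤ 1 := fun b i => hp _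
    obtain ⟨b, hb⟩ : ∃ b, nandProb d (half b p) ≤ nandProb d (half (!b) p) := by
      rcases le_total (nandProb d (half false p)) (nandProb d (half true p)) with h | h
      · exact ⟨false, h⟩
      · exact ⟨true, h⟩
    obtain ⟨T, hT, hc⟩ := ih (half b p) (hph b)
    obtain ⟨T', hT', hc'⟩ := ih (half (!b) p) (hph (!b))
    obtain ⟨S, hS, hcS⟩ := exists_tree_nandTree_succ p b hT hT'
    refine ⟨S, hS, ?_⟩
    rw [hcS, nandProb_succ p b]
    have ha := nandProb_nonneg (hph b)
    set u := nandProb d (half b p)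
    set v := nandProb d (half (!b) p)
    calc _ ≤ (81 / 50) ^ d * (1 + 31 / 100 * (1 - u)) +
          u * ((81 / 50) ^ d * (1 + 31 / 100 * (1 - v))) := by gcongr
      _ = (81 / 50) ^ d * (131 / 100 + u - 31 / 100 * (u * v)) := by ring
      _ ≤ (81 / 50) ^ d * (81 / 50 * (1 + 31 / 100 * (u * v))) := by
          gcongr
          -- As `u * v ≥ u ^ 2`, it suffices that `0.31 - u + 0.8122 * u ^ 2 ≥ 0`. The discriminant
          -- is barely negative, and `5/8` is close to the minimizer.
          nlinarith [mul_le_mul_of_nonneg_left hb ha, sq_nonneg (u - 5 / 8)]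
      _ = _ := by ring

/-! ### From expected cost to worst-case depth -/

theorem prob_le_prodExpect {ι : Type} [Fintype ι] [DecidableEq ι] {p : ι → ℝ}
    {μ : PMF (ι → Bool)}
    (hμ : ∀ x : ι → Bool, (μ x).toReal = ∏ i, (if x i then p i else 1 - p i))
    {S : Set (ι → Bool)} {f : (ι → Bool) → ℝ} (hf : ∀ x, 0 ≤ f x) (hS : ∀ x ∈ S, 1 ≤ f x) :
    prob μ S ≤ prodExpect p f := by
  classical
  rw [prob, PMF.toOuterMeasure_apply_fintype, ENNReal.toReal_sum]
  · refine Finset.sum_le_sum fun x _ => ?_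
    rw [← hμ]
    by_cases hx : x ∈ S
    · simpa [hx] using le_mul_of_one_le_right ENNReal.toReal_nonneg (hS x hx)
    · simpa [hx] using mul_nonneg ENNReal.toReal_nonneg (hf x)
  · intro x _
    by_cases hx : x ∈ S <;> simp [hx, μ.apply_ne_top x]

theorem prodExpect_div {ι : Type} [Fintype ι] [DecidableEq ι] (p : ι → ℝ)
    (f : (ι → Bool) → ℝ) (c : ℝ) : prodExpect p (fun x => f x / c) = prodExpect p f / c := by
  simp [prodExpect, mul_div_assoc, Finset.sum_div]

/-- Truncating a tree after three times its expected number of queries. -/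
theorem distComplexity_le_of_prodExpect_le {ι : Type} [Fintype ι] [DecidableEq ι] {p : ι → ℝ}
    {μ : PMF (ι → Bool)} (hp : ∀ i, 0 ≤ p i ∧ p i ≤ 1)
    (hμ : ∀ x : ι → Bool, (μ x).toReal = ∏ i, (if x i then p i else 1 - p i))
    {g : (ι → Bool) → Bool} {T : DecisionTree ι} (hT : ∀ x, T.eval x = g x) {E : ℝ}
    (hE : prodExpect p (fun x => ((T.queried x).length : ℝ)) ≤ E) :
    (distComplexity (1 / 3) μ g : ℝ) ≤ 3 * E := by
  have hE0 : 0 ≤ E := (prodExpect_nonneg hp fun _ => Nat.cast_nonneg _).trans hE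
  set n := ⌊3 * E⌋₊
  have hn : 3 * E < (n : ℝ) + 1 := Nat.lt_floor_add_one _
  have hn0 : (0 : ℝ) < (n : ℝ) + 1 := by positivity
  have herr : prob μ {x | g x ≠ (T.truncate n).eval x} ≤ 1 / 3 := by
    -- An error forces at least `n + 1` queries, and `n + 1 > 3 * E`, so Markov's inequality gives
    -- probability at most `1/3`.
    calc _ ≤ prodExpect p (fun x => ((T.queried x).length : ℝ) / ((n : ℝ) + 1)) := by
          refine prob_le_prodExpect hμ (fun x => by positivity) fun x hx => ?_
          rw [one_le_div hn0]
          by_contra hlt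
          have hlen : (T.queried x).length ≤ n := by
            push Not at hlt
            have : (T.queried x).length < n + 1 := by exact_mod_cast hlt
            omega
          exact hx (by rw [T.eval_truncate n x hlen, hT])
      _ ≤ 1 / 3 := by
          rw [prodExpect_div, div_le_iff₀ hn0]
          linarith
  have hle : distComplexity (1 / 3) μ g ≤ n :=
    (Nat.sInf_le (s := {k | ∃ T : DecisionTree ι, T.depth = k ∧
      prob μ {x | g x ≠ T.eval x} ≤ 1 / 3}) ⟨_, rfl, herr⟩).trans (T.depth_truncate_le n)
  exact (Nat.cast_le.2 hle).trans (Nat.floor_le (by positivity))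

theorem prodComplexity_nandTree_le (d : ℕ) :
    (prodComplexity (nandTree d) : ℝ) ≤ 4 * (81 / 50) ^ d := by
  obtain ⟨μ, ⟨p, hp, hμ⟩, h⟩ :=
    (prodComplexityErr_attained (ε := 1 / 3) (by norm_num) (nandTree d)).1
  obtain ⟨T, hT, hc⟩ := exists_tree_nandTree_le d p hp
  rw [prodComplexity, ← h]
  refine (distComplexity_le_of_prodExpect_le hp hμ hT hc).trans ?_
  have h1 := nandProb_nonneg hp
  have h2 : (0 : ℝ) < (81 / 50) ^ d := by positivity
  nlinarith

/-! ### The separation -/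

theorem prodComplexity_nandTree_le_sabotageComplexity_rpow (d : ℕ) :
    (prodComplexity (nandTree d) : ℝ) ≤
      48 / 5 * (sabotageComplexity (nandTree d) : ℝ) ^ (1 - 1 / 20 : ℝ) := by
  -- The exponent `19/20` is admissible because `(81/50)^20 ≤ (5/3)^19`, a comparison of rationals.
  have hbase : (81 / 50 : ℝ) ≤ (5 / 3) ^ (19 / 20 : ℝ) := by
    rw [div_eq_mul_inv (19 : ℝ), Real.rpow_mul (by norm_num)]
    refine (Real.le_rpow_inv_iff_of_pos (by norm_num) (by positivity) (by norm_num)).2 ?_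
    exact_mod_cast (by norm_num : (81 / 50 : ℝ) ^ 20 ≤ (5 / 3) ^ 19)
  have hS := le_sabotageComplexity_nandTree d
  set S : ℝ := (sabotageComplexity (nandTree d) : ℝ)
  have hcoef : (12 / 5 : ℝ) ^ (19 / 20 : ℝ) ≤ 12 / 5 := by
    conv_rhs => rw [← Real.rpow_one (12 / 5 : ℝ)]
    exact Real.rpow_le_rpow_of_exponent_le (by norm_num) (by norm_num)
  have hS0 : 0 ≤ S := Nat.cast_nonneg _
  calc _ ≤ 4 * (81 / 50 : ℝ) ^ d := prodComplexity_nandTree_le d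
    _ ≤ 4 * ((5 / 3 : ℝ) ^ (19 / 20 : ℝ)) ^ d := by gcongr
    _ = 4 * ((5 / 3 : ℝ) ^ d) ^ (19 / 20 : ℝ) := by
        rw [← Real.rpow_natCast, ← Real.rpow_natCast, ← Real.rpow_mul (by norm_num),
          ← Real.rpow_mul (by norm_num), mul_comm (d : ℝ)]
    _ ≤ 4 * (12 / 5 * S) ^ (19 / 20 : ℝ) := by
        gcongr
        linarith
    _ = 4 * ((12 / 5) ^ (19 / 20 : ℝ) * S ^ (19 / 20 : ℝ)) := by
        rw [Real.mul_rpow (by norm_num) hS0]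
    _ ≤ 4 * (12 / 5 * S ^ (19 / 20 : ℝ)) := by gcongr
    _ = _ := by norm_num; ring

theorem tendsto_sabotageComplexity_nandTree :
    Filter.Tendsto (fun d => (sabotageComplexity (nandTree d) : ℝ)) Filter.atTop Filter.atTop :=
  Filter.tendsto_atTop_mono le_sabotageComplexity_nandTree
    ((tendsto_pow_atTop_atTop_of_one_lt (by norm_num)).const_mul_atTop (by norm_num))

theorem isLittleO_rpow_mul_log_pow {a : ℝ} (ha : a < 1) (k : ℕ) :
    (fun t : ℝ => t ^ a * Real.log t ^ k) =o[Filter.atTop] fun t => t := by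
  have h : (fun t : ℝ => Real.log t ^ k) =o[Filter.atTop] fun t => t ^ (1 - a) := by
    simpa using isLittleO_log_rpow_rpow_atTop (k : ℝ) (sub_pos.2 ha)
  refine ((Asymptotics.isBigO_refl (fun t : ℝ => t ^ a) Filter.atTop).mul_isLittleO h).congr'
    Filter.EventuallyEq.rfl ?_
  filter_upwards [Filter.eventually_gt_atTop 0] with t ht
  rw [← Real.rpow_add ht]
  simp

end

theorem theorem4 :
    (∃ C c : ℝ, 0 < C ∧ 0 < c ∧ c < 1 ∧ ∀ d : ℕ,
      (prodComplexity (nandTree d) : ℝ) ≤ C * (sabotageComplexity (nandTree d) : ℝ) ^ (1 - c)) ∧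
    (∀ k : ℕ,
      (fun d : ℕ => (prodComplexity (nandTree d) : ℝ) *
        Real.log (sabotageComplexity (nandTree d) : ℝ) ^ k)
      =o[Filter.atTop] (fun d : ℕ => (sabotageComplexity (nandTree d) : ℝ))) := by
  refine ⟨⟨48 / 5, 1 / 20, by norm_num, by norm_num, by norm_num,
    prodComplexity_nandTree_le_sabotageComplexity_rpow⟩, fun k => ?_⟩
  have h := (isLittleO_rpow_mul_log_pow (a := 1 - 1 / 20) (by norm_num) k).comp_tendsto
    tendsto_sabotageComplexity_nandTree
  refine Asymptotics.IsBigO.trans_isLittleO ?_ h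
  refine Asymptotics.IsBigO.mul (Asymptotics.IsBigO.of_bound (48 / 5) ?_)
    (Asymptotics.isBigO_refl _ _)
  refine Filter.Eventually.of_forall fun d => ?_
  rw [Real.norm_of_nonneg (Nat.cast_nonneg _), Real.norm_of_nonneg (by positivity)]
  exact prodComplexity_nandTree_le_sabotageComplexity_rpow d
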